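/- Let $n \ge 1$ be an integer. There exists a compact set $E \subset \mathbb{R}^n$ of Hausdorff dimension $\max(1, n/2)$ such that, writing $D(E) = \{\,|x-y| : x, y \in E\,\}$ for its distance set ($|\cdot|$ being the Euclidean norm): $D(E)$ has Lebesgue measure zero; $D(E)$ contains no nonzero rational number; and every nonzero distance is realised at most once by $E$, that is, if $x,y,u,v \in E$, $x \ne y$ and $|x-y| = |u-v|$, then $\{x,y\} = \{u,v\}$. -/

import Mathlib

/-- The distance set `D(E) = {|x - y| : x, y ∈ E}` of a subset `E` of Euclidean space. -/
def distanceSet {n : ℕ} (E : Set (EuclideanSpace ℝ (Fin n))) : Set ℝ :=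
  {t : ℝ | ∃ x ∈ E, ∃ y ∈ E, t = ‖x - y‖}

/-- Every nonzero distance is realised at most once by `E`: two pairs of points of `E` at the same
nonzero distance consist of the same two points. -/
def RealisesDistancesAtMostOnce {n : ℕ} (E : Set (EuclideanSpace ℝ (Fin n))) : Prop :=
  ∀ x ∈ E, ∀ y ∈ E, ∀ u ∈ E, ∀ v ∈ E, x ≠ y → ‖x - y‖ = ‖u - v‖ →
    (x = u ∧ y = v) ∨ (x = v ∧ y = u)

open MeasureTheory Filter Topology

/-! Points are forced to imitate a lattice at a sparse sequence of scales. Put `N = mesh k` and `σ =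
shift k`; each point is `x = z/N + N^(-d) σ(x) + o(N^(-d))` with `z` integral. For `d = 2`, squaring
gives `N²|x-y|² = integer + 2(x-y)·(σ(x)-σ(y)) + o(1)`; for `d = 1`, coordinatewise, `N(x-y) =
integer + σ(x) - σ(y) + o(1)`.

Suppose `d = 2` and `|x-y|² = |u-v|² + q²` with `q` rational and `x` distinct from `y, u, v`. Let
`σ` be a bump near `x` that vanishes at `y, u, v`, with `2(x-y)·σ(x)` not an integer. If this `σ`
recurs infinitely often, and the denominator of `q` eventually divides `N`, then multiplying by `N²`
brings `2(x-y)·σ(x)` arbitrarily close to integers, which is impossible (`sum_sq_ne_sum_sq_add_rat`;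
`sub_ne_sub_add_rat` for `d = 1`). Countably many rational bumps suffice, so one sequence of shifts
serves all quadruples. Taking `u = v = y` excludes rational distances, and `q = 0` excludes repeated
ones. The zero bump recurs too, so dilated differences or squared distances come uniformly near
integers, and these sets are null.

At scale `N` the set is covered by `O(N^n)` pieces of size `O(N^(-d))`, so its dimension is at most
`n/d`. Rapid growth of the scales makes a Cantor coding of the cube have a Hölder inverse of every
exponent `p/(dp+1)`, whence equality (`dimH_carrier`). Take `d = 1` if `n = 1` and `d = 2`
otherwise. -/

/-- The data of a Cantor-type set of points lying, at infinitely many scales `1 / N`, within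
`o(N ^ (-d))` of the lattice `N⁻¹ ℤⁿ` perturbed by `N ^ (-d)` times the function `shift k`. -/
structure LatticeScheme (n : ℕ) where
  d : ℕ
  d_pos : 0 < d
  shift : ℕ → (Fin n → ℝ) → (Fin n → ℝ)
  bound : ℕ → ℕ
  lipschitz : ∀ k, LipschitzWith (bound k) (shift k)
  norm_shift_le : ∀ k x, ‖shift k x‖ ≤ bound k

/-! ### Scales, compactness and the upper bound for the dimension -/

namespace LatticeScheme

variable {n : ℕ} (S : LatticeScheme n)

/-- Number of children, per coordinate, of a cube of side `1 / D` at stage `k`. -/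
def branchOf (k D : ℕ) : ℕ :=
  -- The first factor outgrows every fixed power of the earlier scales, the factorial makes every
  -- integer eventually divide the mesh, and the last factor makes shift errors negligible.
  (8 * (k + 1) * D) ^ (k + 1) * (k.factorial * (S.bound k + 2) ^ 2)

/-- Inverse side length of the cubes before stage `k`. -/
def res : ℕ → ℕ
  | 0 => 1
  -- A child cube of this side moves `N ^ d • x` by at most `1 / (4 (k + 1))`, a quarter of the
  -- tolerance in `carrier`.
  | k + 1 => 4 * (k + 1) * (2 * res k * S.branchOf k (res k)) ^ S.d

def branch (k : ℕ) : ℕ := S.branchOf k (S.res k)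

/-- The lattice used at stage `k` is `(mesh k)⁻¹ ℤⁿ`. -/
def mesh (k : ℕ) : ℕ := 2 * S.res k * S.branch k

/-- Number, per coordinate, of cubes before stage `k`. -/
def count (k : ℕ) : ℕ := ∏ i ∈ Finset.range k, S.branch i

/-- The set defined by a lattice scheme. -/
def carrier : Set (Fin n → ℝ) :=
  {x | x ∈ Set.Icc 0 1 ∧ ∀ k, ∃ z : Fin n → ℤ,
    ‖(S.mesh k : ℝ) ^ S.d • x - (S.mesh k : ℝ) ^ (S.d - 1) • (fun i => (z i : ℝ)) - S.shift k x‖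
      ≤ 1 / (k + 1)}

theorem res_succ (k : ℕ) : S.res (k + 1) = 4 * (k + 1) * S.mesh k ^ S.d := rfl

theorem branchOf_pos {k D : ℕ} (hD : 0 < D) : 0 < S.branchOf k D := by
  unfold branchOf
  positivity

theorem res_pos (k : ℕ) : 0 < S.res k := by
  induction k with
  | zero => exact Nat.one_pos
  | succ k ih =>
    have := S.branchOf_pos (k := k) ih
    rw [res]
    positivity

theorem branch_pos (k : ℕ) : 0 < S.branch k := S.branchOf_pos (S.res_pos k)

theorem mesh_pos (k : ℕ) : 0 < S.mesh k := by
  have := S.res_pos k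
  have := S.branch_pos k
  unfold mesh
  positivity

theorem count_pos (k : ℕ) : 0 < S.count k := Finset.prod_pos fun i _ => S.branch_pos i

theorem count_succ (k : ℕ) : S.count (k + 1) = S.count k * S.branch k :=
  Finset.prod_range_succ _ _

theorem le_branch (k : ℕ) : 8 * (k + 1) * (S.bound k + 2) ^ 2 ≤ S.branch k := by
  have h1 : 8 * (k + 1) ≤ (8 * (k + 1) * S.res k) ^ (k + 1) :=
    (Nat.le_mul_of_pos_right _ (S.res_pos k)).trans (Nat.le_self_pow (by lia) _)
  have h2 : (S.bound k + 2) ^ 2 ≤ k.factorial * (S.bound k + 2) ^ 2 :=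
    Nat.le_mul_of_pos_left _ k.factorial_pos
  exact Nat.mul_le_mul h1 h2

theorem pow_le_branch (k : ℕ) : (8 * (k + 1) * S.res k) ^ (k + 1) ≤ S.branch k :=
  Nat.le_mul_of_pos_right _ (by positivity)

theorem branch_le_mesh (k : ℕ) : 2 * S.branch k ≤ S.mesh k := by
  unfold mesh
  nlinarith [S.res_pos k, S.branch_pos k]

theorem le_mesh (k : ℕ) : 16 * (k + 1) * (S.bound k + 2) ^ 2 ≤ S.mesh k := by
  linarith [S.le_branch k, S.branch_le_mesh k]

theorem le_mesh' (k : ℕ) : k + 1 ≤ S.mesh k := by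
  have h := S.le_mesh k
  have : 1 ≤ (S.bound k + 2) ^ 2 := Nat.one_le_pow _ _ (by lia)
  nlinarith

theorem factorial_dvd_mesh (k : ℕ) : k.factorial ∣ S.mesh k :=
  Dvd.dvd.mul_left (Dvd.dvd.mul_left (Dvd.intro _ rfl) _) _

theorem eventually_dvd_mesh {m : ℕ} (hm : 0 < m) : ∀ᶠ k in atTop, m ∣ S.mesh k := by
  filter_upwards [eventually_ge_atTop m] with k hk
  exact (Nat.dvd_factorial hm hk).trans (S.factorial_dvd_mesh k)

theorem tendsto_mesh : Tendsto S.mesh atTop atTop :=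
  tendsto_atTop_mono (fun k => (Nat.le_succ k).trans (S.le_mesh' k)) tendsto_id

/-- Growth of the scales: the cubes at stage `k` are numerous compared to their size. -/
theorem res_pow_le (p k : ℕ) (hk : (S.d + 1) * p ≤ k + 1) :
    S.res (k + 1) ^ p ≤ S.count (k + 1) ^ (S.d * p + 1) := by
  set A := 8 * (k + 1) * S.res k with hA
  have hr := S.res_pos k
  have hA1 : 1 ≤ A := Nat.mul_pos (by lia) hr
  have h1 : S.res (k + 1) ≤ A ^ (S.d + 1) * S.branch k ^ S.d := by
    rw [res_succ, mesh, mul_pow, pow_succ']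
    have h2 : 4 * (k + 1) ≤ A := by rw [hA]; nlinarith
    have h3 : 2 * S.res k ≤ A := by rw [hA]; nlinarith
    calc _ ≤ A * (A ^ S.d * S.branch k ^ S.d) := by gcongr
      _ = _ := by ring
  -- The accumulated power of `A` costs only one extra factor `branch k`; this is the `+ 1` in the
  -- exponent.
  calc S.res (k + 1) ^ p ≤ (A ^ (S.d + 1) * S.branch k ^ S.d) ^ p := by gcongr
    _ = A ^ ((S.d + 1) * p) * S.branch k ^ (S.d * p) := by rw [mul_pow, ← pow_mul, ← pow_mul]
    _ ≤ A ^ (k + 1) * S.branch k ^ (S.d * p) := by gcongr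
    _ ≤ S.branch k * S.branch k ^ (S.d * p) := by gcongr; exact S.pow_le_branch k
    _ = S.branch k ^ (S.d * p + 1) := by ring
    _ ≤ S.count (k + 1) ^ (S.d * p + 1) := by
      gcongr
      rw [count_succ]
      exact Nat.le_mul_of_pos_left _ (S.count_pos k)

theorem isClosed_range_smul_int {c : ℝ} (hc : c ≠ 0) :
    IsClosed (Set.range fun z : Fin n → ℤ => c • fun i => (z i : ℝ)) := by
  have h : (Set.range fun z : Fin n → ℤ => c • fun i => (z i : ℝ)) =
      (fun x => c • x) '' Set.pi Set.univ (fun _ : Fin n => Set.range ((↑) : ℤ → ℝ)) := by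
    ext x
    constructor
    · rintro ⟨z, rfl⟩
      exact ⟨_, fun i _ => ⟨z i, rfl⟩, rfl⟩
    · rintro ⟨y, hy, rfl⟩
      choose z hz using fun i => hy i (Set.mem_univ i)
      exact ⟨z, by simp only [hz]⟩
  rw [h]
  exact (Homeomorph.smulOfNeZero c hc).isClosedMap _
    (isClosed_set_pi fun _ _ => Int.isClosedEmbedding_coe_real.isClosed_range)

/-- Each condition says that a continuous map lands in a closed thickening of a lattice; since the
lattice is closed, the thickening is exactly a union of closed balls. -/
theorem isCompact_carrier : IsCompact S.carrier := by
  have h : S.carrier = Set.Icc 0 1 ∩ ⋂ k : ℕ,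
      (fun x => (S.mesh k : ℝ) ^ S.d • x - S.shift k x) ⁻¹'
        Metric.cthickening (1 / (k + 1))
          (Set.range fun z : Fin n → ℤ => (S.mesh k : ℝ) ^ (S.d - 1) • fun i => (z i : ℝ)) := by
    ext x
    simp only [carrier, Set.mem_ofPred_eq, Set.mem_inter_iff, Set.mem_iInter, Set.mem_preimage]
    refine and_congr_right fun _ => forall_congr' fun k => ?_
    have hc : (S.mesh k : ℝ) ^ (S.d - 1) ≠ 0 := by
      have := S.mesh_pos k
      positivity
    rw [(isClosed_range_smul_int hc).cthickening_eq_biUnion_closedBall (by positivity)]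
    simp only [Set.mem_range, Set.iUnion_exists, Set.iUnion_iUnion_eq', Set.mem_iUnion,
      mem_closedBall_iff_norm]
    simp only [sub_right_comm]
  rw [h]
  refine isCompact_Icc.inter_right (isClosed_iInter fun k => ?_)
  refine Metric.isClosed_cthickening.preimage ?_
  exact (continuous_const_smul _).sub (S.lipschitz k).continuous

/-- Points of the set attached to the same lattice point are close to each other. -/
theorem dist_le_of_same_lattice_point {k : ℕ} {x y v : Fin n → ℝ}
    (hx : ‖(S.mesh k : ℝ) ^ S.d • x - v - S.shift k x‖ ≤ 1 / (k + 1))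
    (hy : ‖(S.mesh k : ℝ) ^ S.d • y - v - S.shift k y‖ ≤ 1 / (k + 1)) :
    dist x y ≤ 4 / (S.mesh k : ℝ) ^ S.d := by
  set N : ℝ := (S.mesh k : ℝ) with hN
  have hNb : 16 * ((k : ℝ) + 1) * ((S.bound k : ℝ) + 2) ^ 2 ≤ N := by
    rw [hN]; exact_mod_cast S.le_mesh k
  have hk : (1 : ℝ) / (k + 1) ≤ 1 := by
    rw [div_le_one (by positivity)]; linarith [(Nat.cast_nonneg k : (0 : ℝ) ≤ k)]
  have hN1 : 1 ≤ N := by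
    rw [hN]; exact_mod_cast S.mesh_pos k
  have hNd : N ≤ N ^ S.d := le_self_pow₀ hN1 S.d_pos.ne'
  have hb : 2 * (S.bound k : ℝ) ≤ N := by
    have h0 : (0 : ℝ) ≤ k := Nat.cast_nonneg k
    have h1 : (0 : ℝ) ≤ S.bound k := Nat.cast_nonneg _
    nlinarith [mul_nonneg h0 (sq_nonneg ((S.bound k : ℝ) + 2))]
  have hl : ‖S.shift k x - S.shift k y‖ ≤ S.bound k * ‖x - y‖ := by
    simpa [dist_eq_norm] using (S.lipschitz k).dist_le_mul x y
  have key : N ^ S.d * ‖x - y‖ ≤ 2 + S.bound k * ‖x - y‖ := by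
    calc N ^ S.d * ‖x - y‖ = ‖N ^ S.d • (x - y)‖ := by
          rw [norm_smul, Real.norm_of_nonneg (by positivity)]
      _ = ‖(N ^ S.d • x - v - S.shift k x) - (N ^ S.d • y - v - S.shift k y)
            + (S.shift k x - S.shift k y)‖ := by
          congr 1; rw [smul_sub]; abel
      _ ≤ _ := (norm_add_le _ _).trans (add_le_add ((norm_sub_le _ _).trans (by linarith)) hl)
  rw [dist_eq_norm, le_div_iff₀ (by positivity)]
  -- The Lipschitz term is absorbed, as `bound k` is at most half of `N ^ d`.
  nlinarith [norm_nonneg (x - y)]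

theorem lattice_point_mem_Icc {k : ℕ} {x : Fin n → ℝ} (hx : x ∈ Set.Icc (0 : Fin n → ℝ) 1)
    {z : Fin n → ℤ}
    (hz : ‖(S.mesh k : ℝ) ^ S.d • x - (S.mesh k : ℝ) ^ (S.d - 1) • (fun i => (z i : ℝ))
      - S.shift k x‖ ≤ 1 / (k + 1)) (i : Fin n) :
    z i ∈ Finset.Icc (-(S.bound k + 1 : ℤ)) (S.mesh k + S.bound k + 1) := by
  set N : ℝ := (S.mesh k : ℝ) with hN
  have hN1 : 1 ≤ N := by
    rw [hN]; exact_mod_cast S.mesh_pos k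
  have hk : (1 : ℝ) / (k + 1) ≤ 1 := by
    rw [div_le_one (by positivity)]; linarith [(Nat.cast_nonneg k : (0 : ℝ) ≤ k)]
  obtain ⟨e, he⟩ : ∃ e, S.d = e + 1 := ⟨S.d - 1, by have := S.d_pos; lia⟩
  have h1 := (norm_le_pi_norm _ i).trans hz
  have h2 := (norm_le_pi_norm _ i).trans (S.norm_shift_le k x)
  simp only [Pi.sub_apply, Pi.smul_apply, smul_eq_mul, he, Nat.add_sub_cancel, Real.norm_eq_abs,
    abs_le] at h1 h2
  have hx0 : 0 ≤ x i := hx.1 i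
  have hx1 : x i ≤ 1 := hx.2 i
  have hb : (0 : ℝ) ≤ S.bound k := Nat.cast_nonneg _
  have hNe : 1 ≤ N ^ e := one_le_pow₀ hN1
  have h3 : |N ^ e * (N * x i - z i)| ≤ S.bound k + 1 := by
    rw [abs_le, mul_sub, ← mul_assoc, ← pow_succ]
    constructor <;> linarith
  rw [abs_mul, abs_of_nonneg (by positivity : (0 : ℝ) ≤ N ^ e)] at h3
  have h4 : |N * x i - z i| ≤ S.bound k + 1 := by
    nlinarith [abs_nonneg (N * x i - z i)]
  rw [abs_le] at h4
  rw [Finset.mem_Icc]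
  constructor
  · have : (-(S.bound k + 1 : ℤ) : ℝ) ≤ z i := by push_cast; nlinarith
    exact_mod_cast this
  · have : (z i : ℝ) ≤ N + S.bound k + 1 := by nlinarith
    rw [hN] at this
    exact_mod_cast this

/-- At most `(2N)^n` lattice points are relevant, each with a piece of diameter at most `4/N^d`. The
sums of `n/d`-th powers of diameters stay bounded in `k`, so the `n/d`-dimensional Hausdorff measure
is finite. -/
theorem dimH_carrier_le : dimH S.carrier ≤ (n : ENNReal) / S.d := by
  borelize (Fin n → ℝ)
  have hd := S.d_pos
  let I : ℕ → Finset ℤ := fun k => Finset.Icc (-(S.bound k + 1 : ℤ)) (S.mesh k + S.bound k + 1)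
  let t : ∀ k, (Fin n → I k) → Set (Fin n → ℝ) := fun k z =>
    {x | ‖(S.mesh k : ℝ) ^ S.d • x - (S.mesh k : ℝ) ^ (S.d - 1) • (fun i => ((z i : ℤ) : ℝ))
      - S.shift k x‖ ≤ 1 / (k + 1)}
  let r : ℕ → ENNReal := fun k => ENNReal.ofReal (4 / (S.mesh k : ℝ) ^ S.d)
  have hr : Tendsto r atTop (𝓝 0) := by
    have : Tendsto (fun k => 4 / (S.mesh k : ℝ) ^ S.d) atTop (𝓝 0) :=
      ((tendsto_pow_atTop hd.ne').comp
        (tendsto_natCast_atTop_atTop.comp S.tendsto_mesh)).const_div_atTop 4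
    simpa using ENNReal.tendsto_ofReal this
  have hdiam : ∀ k z, Metric.ediam (t k z) ≤ r k := fun k z =>
    Metric.ediam_le fun x hx y hy => by
      rw [edist_dist]
      exact ENNReal.ofReal_le_ofReal (S.dist_le_of_same_lattice_point hx hy)
  have hcover : ∀ k, S.carrier ⊆ ⋃ z, t k z := fun k x hx => by
    obtain ⟨z, hz⟩ := hx.2 k
    exact Set.mem_iUnion.2 ⟨fun i => ⟨z i, S.lattice_point_mem_Icc hx.1 hz i⟩, hz⟩
  let s : NNReal := n / S.d
  have hs : ((s : NNReal) : ENNReal) = (n : ENNReal) / S.d := by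
    rw [ENNReal.coe_div (by positivity)]; simp
  have hbound : ∀ k, ∑ z, Metric.ediam (t k z) ^ (s : ℝ) ≤ ENNReal.ofReal (2 ^ n * 4 ^ (s : ℝ)) := by
    intro k
    have hN := S.mesh_pos k
    have hcard : (Fintype.card (Fin n → I k) : ℝ) ≤ (2 * S.mesh k : ℝ) ^ n := by
      rw [Fintype.card_fun, Fintype.card_fin, Fintype.card_coe, Int.card_Icc]
      push_cast
      gcongr
      have := S.le_mesh k
      have h : (S.mesh k + S.bound k + 1 + 1 - -(S.bound k + 1 : ℤ)).toNat ≤ 2 * S.mesh k := by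
        have : 2 * S.bound k + 3 ≤ S.mesh k := by nlinarith [Nat.zero_le (S.bound k)]
        lia
      exact_mod_cast h
    calc ∑ z, Metric.ediam (t k z) ^ (s : ℝ) ≤ ∑ _z : Fin n → I k, r k ^ (s : ℝ) :=
          Finset.sum_le_sum fun z _ => ENNReal.rpow_le_rpow (hdiam k z) s.coe_nonneg
      _ = ENNReal.ofReal (Fintype.card (Fin n → I k) * (4 / (S.mesh k : ℝ) ^ S.d) ^ (s : ℝ)) := by
          rw [Finset.sum_const, Finset.card_univ, nsmul_eq_mul, show r k = ENNReal.ofReal _ from rfl,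
            ENNReal.ofReal_rpow_of_nonneg (by positivity) s.coe_nonneg,
            ENNReal.ofReal_mul (by positivity), ENNReal.ofReal_natCast]
      _ ≤ _ := by
          refine ENNReal.ofReal_le_ofReal ?_
          have h1 : ((S.mesh k : ℝ) ^ S.d) ^ (s : ℝ) = (S.mesh k : ℝ) ^ n := by
            rw [← Real.rpow_natCast, ← Real.rpow_mul (by positivity), ← Real.rpow_natCast]
            congr 1
            simp only [s, NNReal.coe_div, NNReal.coe_natCast]
            field_simp
          rw [Real.div_rpow (by positivity) (by positivity), h1]
          calc _ ≤ (2 * S.mesh k : ℝ) ^ n * (4 ^ (s : ℝ) / (S.mesh k : ℝ) ^ n) := by gcongr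
            _ = _ := by rw [mul_pow]; field_simp
  rw [← hs]
  have hμ : μH[(s : ℝ)] S.carrier ≤ ENNReal.ofReal (2 ^ n * 4 ^ (s : ℝ)) :=
    (Measure.hausdorffMeasure_le_liminf_sum (s : ℝ) S.carrier r hr t
      (Eventually.of_forall hdiam) (Eventually.of_forall hcover)).trans
      ((liminf_le_liminf (Eventually.of_forall hbound)).trans_eq (liminf_const _))
  exact dimH_le_of_hausdorffMeasure_ne_top (ne_top_of_le_ne_top ENNReal.ofReal_ne_top hμ)

end LatticeScheme

/-! ### Coding by digits and the lower bound for the dimension -/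

namespace LatticeScheme

variable {n : ℕ} (S : LatticeScheme n)

/-- The stage `k` digits of `y` in the mixed radix system with bases `branch k`. -/
noncomputable def digit (y : Fin n → ℝ) (k : ℕ) (i : Fin n) : ℤ :=
  ⌊(S.count (k + 1) : ℝ) * y i⌋ - S.branch k * ⌊(S.count k : ℝ) * y i⌋

/-- The lattice point in the cube with lower corner `x` selected by the digits of `y`. -/
noncomputable def node (y : Fin n → ℝ) (k : ℕ) (x : Fin n → ℝ) : Fin n → ℝ := fun i =>
  -- The offset `bound k` keeps the shifted node above the corner `x`, whatever the sign of the
  -- shift.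
  ((⌈(S.mesh k : ℝ) * x i⌉ + S.bound k + S.digit y k i : ℤ) : ℝ) / S.mesh k

/-- Lower corners of the nested sequence of cubes selected by the digits of `y`. -/
noncomputable def corner (y : Fin n → ℝ) : ℕ → (Fin n → ℝ)
  | 0 => 0
  | k + 1 => S.node y k (corner y k) +
      ((S.mesh k : ℝ) ^ S.d)⁻¹ • S.shift k (S.node y k (corner y k))

/-- The point of the set whose code is `y`. -/
noncomputable def decode (y : Fin n → ℝ) : Fin n → ℝ := ⨆ k, S.corner y k

theorem digit_nonneg (y : Fin n → ℝ) (k : ℕ) (i : Fin n) : 0 ≤ S.digit y k i := by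
  rw [digit, sub_nonneg, Int.le_floor, count_succ]
  push_cast
  have h := Int.floor_le ((S.count k : ℝ) * y i)
  have := S.branch_pos k
  calc _ ≤ (S.branch k : ℝ) * ((S.count k : ℝ) * y i) := by gcongr
    _ = _ := by ring

theorem digit_lt (y : Fin n → ℝ) (k : ℕ) (i : Fin n) : S.digit y k i < S.branch k := by
  rw [digit, sub_lt_iff_lt_add, Int.floor_lt, count_succ]
  push_cast
  have h := Int.lt_floor_add_one ((S.count k : ℝ) * y i)
  have : (0 : ℝ) < S.branch k := by exact_mod_cast S.branch_pos k
  nlinarith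

theorem one_le_mesh_cast (k : ℕ) : (1 : ℝ) ≤ S.mesh k := by exact_mod_cast S.mesh_pos k

theorem mesh_le_pow (k : ℕ) : (S.mesh k : ℝ) ≤ (S.mesh k : ℝ) ^ S.d :=
  le_self_pow₀ (S.one_le_mesh_cast k) S.d_pos.ne'

theorem norm_shift_div_le (k : ℕ) (a : Fin n → ℝ) :
    ‖((S.mesh k : ℝ) ^ S.d)⁻¹ • S.shift k a‖ ≤ S.bound k / S.mesh k := by
  have hN := S.one_le_mesh_cast k
  rw [norm_smul, norm_inv, Real.norm_of_nonneg (by positivity), inv_mul_eq_div]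
  exact div_le_div₀ (Nat.cast_nonneg _) (S.norm_shift_le k a) (by positivity) (S.mesh_le_pow k)

theorem inv_res_succ_le (k : ℕ) : 1 / (S.res (k + 1) : ℝ) ≤ 1 / (4 * S.mesh k) := by
  have hN := S.one_le_mesh_cast k
  have h := S.mesh_le_pow k
  rw [res_succ]
  push_cast
  have hk : (0 : ℝ) ≤ k := Nat.cast_nonneg k
  exact one_div_le_one_div_of_le (by positivity) (by nlinarith)

theorem le_node (y : Fin n → ℝ) (k : ℕ) (x : Fin n → ℝ) (i : Fin n) :
    x i + S.bound k / S.mesh k ≤ S.node y k x i := by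
  have hN := S.one_le_mesh_cast k
  have h1 := Int.le_ceil ((S.mesh k : ℝ) * x i)
  have h2 : (0 : ℝ) ≤ S.digit y k i := by exact_mod_cast S.digit_nonneg y k i
  rw [node, le_div_iff₀ (by positivity), add_mul, div_mul_cancel₀ _ (by positivity)]
  push_cast
  linarith

theorem node_le (y : Fin n → ℝ) (k : ℕ) (x : Fin n → ℝ) (i : Fin n) :
    S.node y k x i ≤ x i + (S.bound k + S.branch k) / S.mesh k := by
  have hN := S.one_le_mesh_cast k
  have h1 := Int.ceil_lt_add_one ((S.mesh k : ℝ) * x i)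
  have h2 : (S.digit y k i : ℝ) + 1 ≤ S.branch k := by exact_mod_cast S.digit_lt y k i
  rw [node, div_le_iff₀ (by positivity), add_mul, div_mul_cancel₀ _ (by positivity)]
  push_cast
  linarith

theorem corner_le_succ (y : Fin n → ℝ) (k : ℕ) : S.corner y k ≤ S.corner y (k + 1) := by
  intro i
  have h1 := S.le_node y k (S.corner y k) i
  have h2 := (norm_le_pi_norm _ i).trans (S.norm_shift_div_le k (S.node y k (S.corner y k)))
  rw [Real.norm_eq_abs, abs_le] at h2
  rw [corner, Pi.add_apply]
  linarith

/-- Upper corners of the nested sequence of cubes selected by the digits of `y`. -/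
noncomputable def upper (y : Fin n → ℝ) (k : ℕ) : Fin n → ℝ :=
  fun i => S.corner y k i + 1 / S.res k

theorem upper_succ_le (y : Fin n → ℝ) (k : ℕ) : S.upper y (k + 1) ≤ S.upper y k := by
  intro i
  have hN := S.one_le_mesh_cast k
  have hD : (0 : ℝ) < S.res k := by exact_mod_cast S.res_pos k
  have hm : 2 * (S.bound k : ℝ) + 1 ≤ S.branch k := by
    have h := S.le_branch k
    have : 2 * S.bound k + 1 ≤ S.branch k := by nlinarith [Nat.zero_le (S.bound k)]
    exact_mod_cast this
  have h1 := S.node_le y k (S.corner y k) i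
  have h2 := (norm_le_pi_norm _ i).trans (S.norm_shift_div_le k (S.node y k (S.corner y k)))
  have h3 := S.inv_res_succ_le k
  rw [Real.norm_eq_abs, abs_le] at h2
  -- A cube is `2 * branch k` mesh steps wide. Digits use at most half of them; the rest leaves room
  -- for the offset, the shift and the child cube.
  have h4 : 1 / (S.res k : ℝ) = 2 * S.branch k / S.mesh k := by
    have : (0 : ℝ) < S.branch k := by exact_mod_cast S.branch_pos k
    rw [mesh]
    push_cast
    field_simp
  have h5 : (S.bound k + S.branch k) / (S.mesh k : ℝ) + S.bound k / S.mesh k + 1 / (4 * S.mesh k)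
      ≤ 2 * S.branch k / S.mesh k := by
    rw [one_div, mul_inv, ← one_div (S.mesh k : ℝ), ← add_div, mul_one_div, ← add_div]
    gcongr
    linarith
  rw [upper, upper, corner, Pi.add_apply, h4]
  linarith

theorem decode_mem_Icc (y : Fin n → ℝ) (k : ℕ) :
    S.decode y ∈ Set.Icc (S.corner y k) (S.upper y k) := by
  have h := (monotone_nat_of_le_succ (S.corner_le_succ y)).ciSup_mem_iInter_Icc_of_antitone
    (antitone_nat_of_succ_le (S.upper_succ_le y)) (fun k i => by
      rw [upper]
      have : (0 : ℝ) ≤ 1 / S.res k := by positivity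
      linarith)
  exact Set.mem_iInter.1 h k

theorem norm_decode_sub_corner_le (y : Fin n → ℝ) (k : ℕ) :
    ‖S.decode y - S.corner y k‖ ≤ 1 / S.res k := by
  rw [pi_norm_le_iff_of_nonneg (by positivity)]
  intro i
  have h1 := (S.decode_mem_Icc y k).1 i
  have h2 := (S.decode_mem_Icc y k).2 i
  rw [upper] at h2
  rw [Pi.sub_apply, Real.norm_eq_abs, abs_le]
  constructor <;> linarith [(by positivity : (0 : ℝ) ≤ 1 / S.res k)]

/-- The node `a` is the required lattice point. The error has two parts, the distance to the next
corner and the replacement of `shift k a` by `shift k x`, each at most `1 / (4 (k + 1))` after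
scaling. -/
theorem decode_mem_carrier (y : Fin n → ℝ) : S.decode y ∈ S.carrier := by
  refine ⟨?_, fun k => ?_⟩
  · have h := S.decode_mem_Icc y 0
    refine ⟨h.1, h.2.trans fun i => ?_⟩
    simp [upper, corner, res]
  set a := S.node y k (S.corner y k) with ha
  refine ⟨fun i => ⌈(S.mesh k : ℝ) * S.corner y k i⌉ + S.bound k + S.digit y k i, ?_⟩
  have hN := S.one_le_mesh_cast k
  have hk : (0 : ℝ) ≤ k := Nat.cast_nonneg k
  have hK : (0 : ℝ) ≤ S.bound k := Nat.cast_nonneg _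
  have hNK : 16 * ((k : ℝ) + 1) * ((S.bound k : ℝ) + 2) ^ 2 ≤ S.mesh k := by
    exact_mod_cast S.le_mesh k
  set N : ℝ := (S.mesh k : ℝ) with hNdef
  have hz : (N ^ (S.d - 1)) • (fun i => (((⌈N * S.corner y k i⌉ + S.bound k + S.digit y k i : ℤ)) : ℝ))
      = N ^ S.d • a := by
    ext i
    rw [Pi.smul_apply, Pi.smul_apply, ha, node, ← hNdef, smul_eq_mul, smul_eq_mul,
      ← Nat.sub_add_cancel S.d_pos, pow_succ, Nat.add_sub_cancel]
    field_simp
  rw [hz]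
  set x := S.decode y
  set c := S.corner y (k + 1) with hc
  have hxc : ‖x - c‖ ≤ 1 / S.res (k + 1) := S.norm_decode_sub_corner_le y (k + 1)
  have hca : c = a + (N ^ S.d)⁻¹ • S.shift k a := by rw [hc, corner]
  have hid : N ^ S.d • x - N ^ S.d • a - S.shift k x
      = N ^ S.d • (x - c) + (S.shift k a - S.shift k x) := by
    rw [hca, smul_sub, smul_add, smul_inv_smul₀ (by positivity)]
    abel
  have h1 : ‖N ^ S.d • (x - c)‖ ≤ 1 / (4 * (k + 1)) := by
    rw [norm_smul, Real.norm_of_nonneg (by positivity)]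
    calc _ ≤ N ^ S.d * (1 / S.res (k + 1)) := by gcongr
      _ = _ := by rw [res_succ]; push_cast; rw [← hNdef]; field_simp
  have h2 : ‖a - x‖ ≤ (S.bound k + 1) / N := by
    have h3 : ‖c - a‖ ≤ S.bound k / N := by
      rw [hca, add_sub_cancel_left]; exact S.norm_shift_div_le k a
    have h4 := S.inv_res_succ_le k
    have h5 : 1 / (4 * N) ≤ 1 / N := by gcongr; linarith
    have h6 : ‖a - x‖ ≤ ‖x - c‖ + ‖c - a‖ := by
      rw [norm_sub_rev a x]; exact norm_sub_le_norm_sub_add_norm_sub x c a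
    rw [add_div]
    linarith
  have h3 : ‖S.shift k a - S.shift k x‖ ≤ 1 / (4 * (k + 1)) := by
    have h4 : ‖S.shift k a - S.shift k x‖ ≤ S.bound k * ‖a - x‖ := by
      simpa [dist_eq_norm] using (S.lipschitz k).dist_le_mul a x
    refine h4.trans ((mul_le_mul_of_nonneg_left h2 hK).trans ?_)
    rw [← mul_div_assoc, div_le_div_iff₀ (by positivity) (by positivity)]
    nlinarith [mul_nonneg hk hK, mul_nonneg hk (mul_nonneg hK hK), mul_nonneg hK hK]
  rw [hid]
  refine (norm_add_le _ _).trans ((add_le_add h1 h3).trans ?_)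
  rw [← add_div, div_le_div_iff₀ (by positivity) (by positivity)]
  nlinarith

theorem corner_eq_of_floor_eq {y y' : Fin n → ℝ} {k : ℕ}
    (h : ∀ j ≤ k, ∀ i, ⌊(S.count j : ℝ) * y i⌋ = ⌊(S.count j : ℝ) * y' i⌋) :
    S.corner y k = S.corner y' k := by
  induction k with
  | zero => rfl
  | succ k ih =>
    have hn : ∀ x, S.node y k x = S.node y' k x := fun x => by
      ext i
      simp only [node, digit, h k (by lia) i, h (k + 1) le_rfl i]
    rw [corner, corner, ih fun j hj => h j (by lia), hn]

/-- Codes that first differ at stage `k + 1` share a parent cube and select distinct nodes at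
distance `δ`. Both `‖y - y'‖` and the distance of the decoded points are compared with `δ`. -/
theorem norm_sub_le_of_floor_ne {y y' : Fin n → ℝ} {k : ℕ} {r : ℝ} (hr1 : r ≤ 1) (hr0 : 0 < r)
    (h : ∀ j ≤ k, ∀ i, ⌊(S.count j : ℝ) * y i⌋ = ⌊(S.count j : ℝ) * y' i⌋)
    (h' : ∃ i, ⌊(S.count (k + 1) : ℝ) * y i⌋ ≠ ⌊(S.count (k + 1) : ℝ) * y' i⌋) :
    ‖y - y'‖ ≤ 2 / S.count k * (8 * S.res k) ^ r * ‖S.decode y - S.decode y'‖ ^ r := by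
  have hcor := S.corner_eq_of_floor_eq h
  have hN := S.one_le_mesh_cast k
  have hD : (0 : ℝ) < S.res k := by exact_mod_cast S.res_pos k
  have hm : (0 : ℝ) < S.branch k := by exact_mod_cast S.branch_pos k
  have hM : (0 : ℝ) < S.count k := by exact_mod_cast S.count_pos k
  have hMs : (S.count (k + 1) : ℝ) = S.count k * S.branch k := by
    rw [count_succ]; push_cast; rfl
  have hND : (S.mesh k : ℝ) = 2 * S.res k * S.branch k := by rw [mesh]; push_cast; rfl
  set a := S.node y k (S.corner y k) with ha
  set a' := S.node y' k (S.corner y' k) with ha'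
  set δ := ‖a - a'‖ with hδ
  have hdiff : ∀ i, S.mesh k * (a i - a' i) = (S.digit y k i - S.digit y' k i : ℤ) := fun i => by
    rw [ha, ha', hcor, node, node]
    push_cast
    field_simp
    ring
  have hdig : ∀ i, S.digit y k i - S.digit y' k i =
      ⌊(S.count (k + 1) : ℝ) * y i⌋ - ⌊(S.count (k + 1) : ℝ) * y' i⌋ := fun i => by
    rw [digit, digit, h k le_rfl i]; ring
  have habs : ∀ i, |((S.digit y k i - S.digit y' k i : ℤ) : ℝ)| ≤ S.mesh k * δ := fun i => by
    rw [← hdiff, abs_mul, abs_of_pos (by positivity : (0 : ℝ) < S.mesh k)]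
    gcongr
    exact norm_le_pi_norm (a - a') i
  have hδ1 : 1 ≤ S.mesh k * δ := by
    obtain ⟨i, hi⟩ := h'
    refine le_trans ?_ (habs i)
    have : 1 ≤ |S.digit y k i - S.digit y' k i| := by
      rw [hdig]; exact Int.one_le_abs (sub_ne_zero.2 hi)
    exact_mod_cast this
  have hδpos : 0 < δ := by
    by_contra hcon
    nlinarith
  have hδ2 : 2 * S.res k * δ ≤ 1 := by
    have hle : δ ≤ 1 / (2 * S.res k) := by
      rw [hδ, pi_norm_le_iff_of_nonneg (by positivity)]
      intro i
      have h1 : |((S.digit y k i - S.digit y' k i : ℤ) : ℝ)| ≤ S.branch k := by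
        have h2 := S.digit_lt y k i
        have h3 := S.digit_lt y' k i
        have h4 := S.digit_nonneg y k i
        have h5 := S.digit_nonneg y' k i
        have : |S.digit y k i - S.digit y' k i| ≤ S.branch k := by rw [abs_le]; lia
        exact_mod_cast this
      rw [← hdiff, abs_mul, abs_of_pos (by positivity : (0 : ℝ) < S.mesh k), hND] at h1
      rw [Pi.sub_apply, Real.norm_eq_abs, le_div_iff₀ (by positivity)]
      nlinarith
    rw [le_div_iff₀ (by positivity)] at hle
    linarith
  have hy : ‖y - y'‖ ≤ 2 / S.count k * (2 * S.res k * δ) := by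
    rw [pi_norm_le_iff_of_nonneg (by positivity)]
    intro i
    have h1 := habs i
    rw [hdig] at h1
    push_cast at h1
    rw [abs_le] at h1
    have h2 := Int.floor_le ((S.count (k + 1) : ℝ) * y i)
    have h3 := Int.lt_floor_add_one ((S.count (k + 1) : ℝ) * y i)
    have h4 := Int.floor_le ((S.count (k + 1) : ℝ) * y' i)
    have h5 := Int.lt_floor_add_one ((S.count (k + 1) : ℝ) * y' i)
    have h6 : |S.count (k + 1) * (y i - y' i)| ≤ 2 * (S.mesh k * δ) := by
      rw [abs_le]; constructor <;> nlinarith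
    rw [abs_mul, Nat.abs_cast, hMs, hND] at h6
    rw [Pi.sub_apply, Real.norm_eq_abs, div_mul_eq_mul_div, le_div_iff₀ hM]
    have h7 : S.branch k * (|y i - y' i| * S.count k) ≤ S.branch k * (2 * (2 * S.res k * δ)) := by
      linarith
    exact le_of_mul_le_mul_left h7 hm
  -- The two tails cost at most `δ / 4` each and the shifts `δ / 16`, so a definite fraction of `δ`
  -- survives.
  have hx : δ ≤ 4 * ‖S.decode y - S.decode y'‖ := by
    have h1 := S.norm_decode_sub_corner_le y (k + 1)
    have h2 := S.norm_decode_sub_corner_le y' (k + 1)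
    have h3 := S.inv_res_succ_le k
    have h4 : ‖((S.mesh k : ℝ) ^ S.d)⁻¹ • (S.shift k a - S.shift k a')‖ ≤ δ / 16 := by
      have h5 : ‖S.shift k a - S.shift k a'‖ ≤ S.bound k * δ := by
        simpa [dist_eq_norm] using (S.lipschitz k).dist_le_mul a a'
      have h6 : 16 * (S.bound k : ℝ) ≤ (S.mesh k : ℝ) ^ S.d := by
        have h7 := S.le_mesh k
        have h8 : 16 * S.bound k ≤ S.mesh k := by nlinarith [Nat.zero_le (S.bound k)]
        exact le_trans (by exact_mod_cast h8) (S.mesh_le_pow k)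
      rw [norm_smul, norm_inv, Real.norm_of_nonneg (by positivity), inv_mul_eq_div,
        div_le_div_iff₀ (by positivity) (by positivity)]
      nlinarith
    have h9 : 1 / (4 * (S.mesh k : ℝ)) ≤ δ / 4 := by
      rw [div_le_div_iff₀ (by positivity) (by positivity)]; nlinarith
    have hid : a - a' = (S.decode y - S.decode y') - (S.decode y - S.corner y (k + 1))
        + (S.decode y' - S.corner y' (k + 1))
        - ((S.mesh k : ℝ) ^ S.d)⁻¹ • (S.shift k a - S.shift k a') := by
      rw [corner, corner, ← ha, ← ha', smul_sub]; abel
    have h10 : δ ≤ ‖S.decode y - S.decode y'‖ + ‖S.decode y - S.corner y (k + 1)‖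
        + ‖S.decode y' - S.corner y' (k + 1)‖
        + ‖((S.mesh k : ℝ) ^ S.d)⁻¹ • (S.shift k a - S.shift k a')‖ := by
      rw [hδ, hid]
      refine (norm_sub_le _ _).trans (add_le_add_left ?_ _)
      refine (norm_add_le _ _).trans (add_le_add_left ?_ _)
      exact norm_sub_le _ _
    linarith [norm_nonneg (S.decode y - S.decode y')]
  calc ‖y - y'‖ ≤ 2 / S.count k * (2 * S.res k * δ) := hy
    _ ≤ 2 / S.count k * (2 * S.res k * δ) ^ r := by
        gcongr
        exact Real.self_le_rpow_of_le_one (by positivity) hδ2 hr1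
    _ ≤ 2 / S.count k * (8 * S.res k * ‖S.decode y - S.decode y'‖) ^ r := by
        refine mul_le_mul_of_nonneg_left ?_ (by positivity)
        exact Real.rpow_le_rpow (by positivity) (by nlinarith) hr0.le
    _ = _ := by rw [Real.mul_rpow (by positivity) (by positivity), mul_assoc]

theorem le_count (k : ℕ) : k ≤ S.count k := by
  induction k with
  | zero => exact Nat.zero_le _
  | succ k ih =>
    have h1 := S.le_branch k
    have h2 : 2 ≤ S.branch k := by nlinarith [Nat.zero_le (S.bound k)]
    have h3 := S.count_pos k
    rw [count_succ]
    nlinarith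

theorem exists_floor_ne {y y' : Fin n → ℝ} (h : y ≠ y') :
    ∃ k, ∃ i, ⌊(S.count k : ℝ) * y i⌋ ≠ ⌊(S.count k : ℝ) * y' i⌋ := by
  by_contra! hcon
  refine h (funext fun i => ?_)
  by_contra hi
  have hpos : 0 < |y i - y' i| := abs_pos.2 (sub_ne_zero.2 hi)
  obtain ⟨k, hk⟩ := exists_nat_gt (1 / |y i - y' i|)
  have h1 := Int.abs_sub_lt_one_of_floor_eq_floor (hcon k i)
  rw [← mul_sub, abs_mul, Nat.abs_cast] at h1
  rw [div_lt_iff₀ hpos] at hk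
  have h2 : (k : ℝ) ≤ S.count k := by exact_mod_cast S.le_count k
  nlinarith

/-- By `res_pow_le` this exponent gives `res k ^ r ≤ count k` for large `k`; the finitely many other
stages only affect the constant. -/
theorem exists_holder_const (p : ℕ) :
    ∃ C : ℝ, ∀ k, 2 / S.count k * (8 * S.res k) ^ ((p : ℝ) / (S.d * p + 1)) ≤ C := by
  set r : ℝ := (p : ℝ) / (S.d * p + 1) with hr
  have hb : BddAbove (Set.range fun k => 2 / (S.count k : ℝ) * (8 * S.res k) ^ r) := by
    refine IsBoundedUnder.bddAbove_range ⟨2 * 8 ^ r, ?_⟩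
    rw [eventually_map]
    filter_upwards [eventually_ge_atTop ((S.d + 1) * p + 1)] with k hk
    obtain ⟨k, rfl⟩ : ∃ j, k = j + 1 := ⟨k - 1, by lia⟩
    have h1 : (S.res (k + 1) : ℝ) ^ p ≤ (S.count (k + 1) : ℝ) ^ (S.d * p + 1) := by
      exact_mod_cast S.res_pow_le p k (by lia)
    have hM : (0 : ℝ) < S.count (k + 1) := by exact_mod_cast S.count_pos _
    have h2 : (S.res (k + 1) : ℝ) ^ r ≤ S.count (k + 1) := by
      have h3 := Real.rpow_le_rpow (by positivity) h1
        (by positivity : (0 : ℝ) ≤ 1 / ((S.d * p + 1 : ℕ) : ℝ))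
      rw [← Real.rpow_natCast, ← Real.rpow_natCast, ← Real.rpow_mul (by positivity),
        ← Real.rpow_mul (by positivity), mul_one_div_cancel (by positivity), Real.rpow_one,
        mul_one_div] at h3
      rw [hr]
      exact_mod_cast h3
    rw [Real.mul_rpow (by positivity) (by positivity), div_mul_eq_mul_div, div_le_iff₀ hM]
    have : (0 : ℝ) < 8 ^ r := by positivity
    nlinarith
  obtain ⟨C, hC⟩ := hb
  exact ⟨C, fun k => hC ⟨k, rfl⟩⟩

theorem exists_norm_sub_le {p : ℕ} (hp : 0 < p) :
    ∃ C : NNReal, ∀ y ∈ Set.pi Set.univ (fun _ : Fin n => Set.Ico (0 : ℝ) 1),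
      ∀ y' ∈ Set.pi Set.univ (fun _ : Fin n => Set.Ico (0 : ℝ) 1),
      ‖y - y'‖ ≤ C * ‖S.decode y - S.decode y'‖ ^ ((p : ℝ) / (S.d * p + 1)) := by
  obtain ⟨C, hC⟩ := S.exists_holder_const p
  refine ⟨C.toNNReal, fun y hy y' hy' => ?_⟩
  have hd := S.d_pos
  rcases eq_or_ne y y' with rfl | hne
  · rw [sub_self, norm_zero]; positivity
  classical
  have hex := S.exists_floor_ne hne
  -- Stage `0` cannot separate codes: `count 0 = 1` and coordinates lie in `[0, 1)`.
  obtain ⟨k, hk⟩ : ∃ k, Nat.find hex = k + 1 := by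
    refine Nat.exists_eq_succ_of_ne_zero fun h0 => ?_
    obtain ⟨i, hi⟩ := h0 ▸ Nat.find_spec hex
    refine hi ?_
    simp only [count, Finset.range_zero, Finset.prod_empty, Nat.cast_one, one_mul]
    rw [Int.floor_eq_zero_iff.2 (hy i trivial), Int.floor_eq_zero_iff.2 (hy' i trivial)]
  have h1 : ∀ j ≤ k, ∀ i, ⌊(S.count j : ℝ) * y i⌋ = ⌊(S.count j : ℝ) * y' i⌋ := fun j hj => by
    have := Nat.find_min hex (m := j) (by lia)
    push Not at this
    exact this
  have hr1 : (p : ℝ) / (S.d * p + 1) ≤ 1 := by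
    rw [div_le_one (by positivity)]
    have : p ≤ S.d * p + 1 := by nlinarith
    exact_mod_cast this
  refine (S.norm_sub_le_of_floor_ne hr1 (by positivity) h1 (hk ▸ Nat.find_spec hex)).trans ?_
  gcongr
  exact (hC k).trans (Real.le_coe_toNNReal C)

/-- The inverse of `decode` is Hölder of exponent `r` and maps onto a cube of dimension `n`, and
such a map multiplies dimension by at most `1 / r`. -/
theorem le_dimH_carrier_of_pos {p : ℕ} (hp : 0 < p) :
    (n : ENNReal) * ((p / (S.d * p + 1) : NNReal) : ENNReal) ≤ dimH S.carrier := by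
  have hd := S.d_pos
  set Q := Set.pi Set.univ (fun _ : Fin n => Set.Ico (0 : ℝ) 1) with hQ
  set r : NNReal := p / (S.d * p + 1) with hr
  have hrr : (r : ℝ) = (p : ℝ) / (S.d * p + 1) := by rw [hr]; push_cast; rfl
  have hr0 : 0 < r := by rw [hr]; positivity
  obtain ⟨C, hC⟩ := S.exists_norm_sub_le hp
  rw [← hrr] at hC
  have hinj : Set.InjOn S.decode Q := fun y hy y' hy' h => by
    have := hC y hy y' hy'
    rw [h, sub_self, norm_zero, Real.zero_rpow (by positivity), mul_zero] at this
    exact sub_eq_zero.1 (norm_le_zero_iff.1 this)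
  have hinv : Set.LeftInvOn (Function.invFunOn S.decode Q) S.decode Q := hinj.leftInvOn_invFunOn
  have hhol : HolderOnWith C r (Function.invFunOn S.decode Q) (S.decode '' Q) := by
    rintro _ ⟨y, hy, rfl⟩ _ ⟨y', hy', rfl⟩
    rw [hinv hy, hinv hy', edist_dist, edist_dist, dist_eq_norm, dist_eq_norm,
      ENNReal.ofReal_rpow_of_nonneg (norm_nonneg _) r.coe_nonneg, ← ENNReal.ofReal_coe_nnreal,
      ← ENNReal.ofReal_mul C.coe_nonneg]
    exact ENNReal.ofReal_le_ofReal (hC y hy y' hy')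
  have h1 := hhol.dimH_image_le hr0
  have h2 : dimH Q = n := by
    rw [Real.dimH_of_nonempty_interior, Module.finrank_fin_fun]
    rw [hQ, interior_pi_set Set.finite_univ]
    refine ⟨fun _ => 1 / 2, fun i _ => ?_⟩
    change (1 / 2 : ℝ) ∈ interior (Set.Ico 0 1)
    rw [interior_Ico]
    norm_num
  rw [hinv.image_image, h2, ENNReal.le_div_iff_mul_le (Or.inl (by simpa using hr0.ne'))
    (Or.inl ENNReal.coe_ne_top)] at h1
  refine h1.trans (dimH_mono ?_)
  rintro _ ⟨y, -, rfl⟩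
  exact S.decode_mem_carrier y

theorem dimH_carrier : dimH S.carrier = (n : ENNReal) / S.d := by
  refine le_antisymm S.dimH_carrier_le ?_
  have hd : (S.d : NNReal) ≠ 0 := by exact_mod_cast S.d_pos.ne'
  have h1 : Tendsto (fun p : ℕ => ((p / (S.d * p + 1) : NNReal))) atTop
      (𝓝 ((S.d : NNReal)⁻¹)) := by
    have h2 : Tendsto (fun p : ℕ => ((S.d : NNReal) + (p : NNReal)⁻¹)⁻¹) atTop
        (𝓝 ((S.d : NNReal)⁻¹)) := by
      have h3 : Tendsto (fun p : ℕ => (S.d : NNReal) + (p : NNReal)⁻¹) atTop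
          (𝓝 ((S.d : NNReal) + 0)) :=
        tendsto_const_nhds.add (tendsto_inv_atTop_zero.comp tendsto_natCast_atTop_atTop)
      rw [add_zero] at h3
      exact h3.inv₀ hd
    refine h2.congr' ?_
    filter_upwards [eventually_gt_atTop 0] with p hp
    field_simp
  have h2 : Tendsto (fun p : ℕ => (n : ENNReal) * ((p / (S.d * p + 1) : NNReal) : ENNReal)) atTop
      (𝓝 ((n : ENNReal) * ((S.d : NNReal)⁻¹ : NNReal))) :=
    ENNReal.Tendsto.const_mul (ENNReal.tendsto_coe.2 h1) (Or.inr (by simp))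
  rw [ENNReal.coe_inv hd, ENNReal.coe_natCast, ← div_eq_mul_inv] at h2
  refine le_of_tendsto h2 ?_
  filter_upwards [eventually_gt_atTop 0] with p hp
  exact S.le_dimH_carrier_of_pos hp

end LatticeScheme

/-! ### Rational bumps and approximation by integers -/

/-- A bump function of height `w` supported in the ball of radius `1 / R` about a rational point. -/
noncomputable def rationalBump {n : ℕ} (t : (Fin n → ℚ) × ℕ × (Fin n → ℚ)) (x : Fin n → ℝ) :
    Fin n → ℝ :=
  max 0 (1 - t.2.1 * ‖x - fun i => (t.1 i : ℝ)‖) • fun i => (t.2.2 i : ℝ)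

theorem exists_lipschitzWith_rationalBump {n : ℕ} (t : (Fin n → ℚ) × ℕ × (Fin n → ℚ)) :
    ∃ K : ℕ, LipschitzWith K (rationalBump t) ∧ ∀ x, ‖rationalBump t x‖ ≤ K := by
  obtain ⟨p, R, w⟩ := t
  set p' : Fin n → ℝ := fun i => (p i : ℝ) with hp
  set w' : Fin n → ℝ := fun i => (w i : ℝ) with hw
  obtain ⟨K, hK⟩ := exists_nat_ge (((R : ℝ) + 1) * ‖w'‖)
  have hw0 := norm_nonneg w'
  have hR : (0 : ℝ) ≤ R := Nat.cast_nonneg R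
  refine ⟨K, LipschitzWith.of_dist_le_mul fun x y => ?_, fun x => ?_⟩
  · have h1 : |max 0 (1 - R * ‖x - p'‖) - max 0 (1 - R * ‖y - p'‖)| ≤ R * ‖x - y‖ := by
      refine (abs_max_sub_max_le_max _ _ _ _).trans ?_
      rw [sub_self, abs_zero, sub_sub_sub_cancel_left, ← mul_sub, abs_mul, Nat.abs_cast]
      refine max_le (by positivity) ?_
      gcongr
      rw [abs_sub_comm]
      refine (abs_norm_sub_norm_le _ _).trans_eq ?_
      rw [sub_sub_sub_cancel_right]
    rw [dist_eq_norm, dist_eq_norm, rationalBump, rationalBump, ← sub_smul, norm_smul,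
      Real.norm_eq_abs]
    calc _ ≤ R * ‖x - y‖ * ‖w'‖ := by gcongr
      _ ≤ (((R : ℝ) + 1) * ‖w'‖) * ‖x - y‖ := by
        nlinarith [norm_nonneg (x - y), mul_nonneg hw0 (norm_nonneg (x - y))]
      _ ≤ _ := by gcongr; exact hK
  · rw [rationalBump, norm_smul, Real.norm_of_nonneg (le_max_left _ _)]
    have h1 : max 0 (1 - R * ‖x - p'‖) ≤ 1 :=
      max_le zero_le_one (by linarith [mul_nonneg hR (norm_nonneg (x - p'))])
    calc _ ≤ 1 * ‖w'‖ := by gcongr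
      _ ≤ K := by nlinarith

theorem exists_rat_mul_not_int {c : ℝ} (hc : c ≠ 0) :
    ∃ q : ℚ, (q : ℝ) * c ∉ Set.range ((↑) : ℤ → ℝ) := by
  have main : ∀ c : ℝ, 0 < c → ∃ q : ℚ, (q : ℝ) * c ∉ Set.range ((↑) : ℤ → ℝ) := by
    intro c hc
    obtain ⟨q, hq0, hq1⟩ := exists_rat_btwn (show (0 : ℝ) < 1 / c by positivity)
    refine ⟨q, ?_⟩
    rintro ⟨m, hm⟩
    rw [lt_div_iff₀ hc, ← hm] at hq1
    have h0 : (0 : ℝ) < m := hm ▸ mul_pos hq0 hc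
    have h1 : m < 1 := by exact_mod_cast hq1
    have h2 : 0 < m := by exact_mod_cast h0
    lia
  rcases hc.lt_or_gt with h | h
  · obtain ⟨q, hq⟩ := main (-c) (by linarith)
    exact ⟨-q, by simpa using hq⟩
  · exact main c h

/-- A ball of radius `1 / R` with rational centre near `x` misses `y, u, v` once `R` is large.
Pointing the bump along a coordinate with `a i ≠ 0` makes the sum a rational multiple of a nonzero
real, and a suitable rational height makes it non-integral. -/
theorem exists_rationalBump_separating {n : ℕ} {x y u v a : Fin n → ℝ} (hy : x ≠ y) (hu : x ≠ u)
    (hv : x ≠ v) (ha : a ≠ 0) :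
    ∃ t, rationalBump t y = 0 ∧ rationalBump t u = 0 ∧ rationalBump t v = 0 ∧
      ∑ i, a i * rationalBump t x i ∉ Set.range ((↑) : ℤ → ℝ) := by
  obtain ⟨i, hi⟩ := Function.ne_iff.1 ha
  have hpos : 0 < min (dist x y) (min (dist x u) (dist x v)) :=
    lt_min (dist_pos.2 hy) (lt_min (dist_pos.2 hu) (dist_pos.2 hv))
  obtain ⟨R, hR⟩ := exists_nat_gt (2 / min (dist x y) (min (dist x u) (dist x v)))
  have hR0 : (0 : ℝ) < R := lt_trans (by positivity) hR
  have hdense : DenseRange fun p : Fin n → ℚ => fun j => (p j : ℝ) :=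
    DenseRange.piMap fun _ => Rat.denseRange_cast
  obtain ⟨p, hp⟩ := hdense.exists_dist_lt x (show (0 : ℝ) < 1 / R by positivity)
  set p' : Fin n → ℝ := fun j => (p j : ℝ)
  rw [lt_div_iff₀ hR0, dist_eq_norm] at hp
  set c := max 0 (1 - R * ‖x - p'‖) with hc
  have hcpos : 0 < c := lt_max_of_lt_right (by linarith)
  obtain ⟨q, hq⟩ := exists_rat_mul_not_int (mul_ne_zero hi hcpos.ne')
  have hvanish : ∀ y' (w : Fin n → ℚ),
      min (dist x y) (min (dist x u) (dist x v)) ≤ dist x y' → rationalBump (p, R, w) y' = 0 := by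
    intro y' w hle
    rw [div_lt_iff₀ hpos] at hR
    have h1 : dist x y' ≤ ‖x - p'‖ + ‖y' - p'‖ := by
      rw [← dist_eq_norm, ← dist_eq_norm]; exact dist_triangle_right _ _ _
    have h2 : 1 - R * ‖y' - p'‖ ≤ 0 := by nlinarith
    rw [rationalBump, max_eq_left h2, zero_smul]
  refine ⟨(p, R, Pi.single i q), hvanish y _ (min_le_left _ _),
    hvanish u _ ((min_le_right _ _).trans (min_le_left _ _)),
    hvanish v _ ((min_le_right _ _).trans (min_le_right _ _)), ?_⟩
  rw [Finset.sum_eq_single i (fun j _ hj => by simp [rationalBump, hj]) (by simp)]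
  have : a i * rationalBump (p, R, Pi.single i q) x i = q * (a i * c) := by
    simp only [rationalBump, Pi.smul_apply, Pi.single_eq_same, smul_eq_mul]
    ring
  rwa [this]

/-- Enumerate `ℕ × ι` and forget the first coordinate. -/
theorem exists_seq_frequently_eq (ι : Type*) [Nonempty ι] [Countable ι] :
    ∃ f : ℕ → ι, ∀ t, ∃ᶠ k in atTop, f k = t := by
  obtain ⟨g, hg⟩ := exists_surjective_nat (ℕ × ι)
  refine ⟨fun k => (g k).2, fun t => ?_⟩
  rw [Nat.frequently_atTop_iff_infinite]
  have h : (Set.range fun m : ℕ => Function.surjInv hg (m, t)).Infinite :=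
    Set.infinite_range_of_injective fun a b hab => by
      simpa using Function.injective_surjInv hg hab
  refine h.mono ?_
  rintro _ ⟨m, rfl⟩
  simp [Function.surjInv_eq hg]

theorem exists_latticeScheme (n : ℕ) {d : ℕ} (hd : 0 < d) :
    ∃ S : LatticeScheme n, S.d = d ∧ ∀ t, ∃ᶠ k in atTop, S.shift k = rationalBump t := by
  obtain ⟨f, hf⟩ := exists_seq_frequently_eq ((Fin n → ℚ) × ℕ × (Fin n → ℚ))
  choose K hK using fun k => exists_lipschitzWith_rationalBump (f k)
  exact ⟨⟨d, hd, fun k => rationalBump (f k), K, fun k => (hK k).1, fun k => (hK k).2⟩, rfl,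
    fun t => (hf t).mono fun k hk => congrArg rationalBump hk⟩

theorem mem_range_intCast_of_frequently {c C : ℝ}
    (h : ∃ᶠ k : ℕ in atTop, ∃ m : ℤ, |c - m| ≤ C / (k + 1)) :
    c ∈ Set.range ((↑) : ℤ → ℝ) := by
  by_contra hc
  obtain ⟨ε, hε, hball⟩ := Metric.isOpen_iff.1
    Int.isClosedEmbedding_coe_real.isClosed_range.isOpen_compl c hc
  have hlim : Tendsto (fun k : ℕ => C / ((k : ℝ) + 1)) atTop (𝓝 0) :=
    (tendsto_atTop_add_const_right _ _ tendsto_natCast_atTop_atTop).const_div_atTop C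
  obtain ⟨k, ⟨m, hm⟩, hk⟩ := (h.and_eventually (hlim.eventually (gt_mem_nhds hε))).exists
  have hmem : (m : ℝ) ∈ Metric.ball c ε := by
    rw [Metric.mem_ball, dist_comm, Real.dist_eq]
    exact hm.trans_lt hk
  exact hball hmem ⟨m, rfl⟩

/-- A set of reals is null if a dilation of it is arbitrarily close to the integers. -/
theorem volume_eq_zero_of_near_int {s : Set ℝ}
    (h : ∀ η > 0, ∃ A : ℕ, 0 < A ∧ ∀ t ∈ s, ∃ m : ℤ, |A * t - m| ≤ η) : volume s = 0 := by
  have hB : ∀ B : ℕ, volume (s ∩ Set.Icc (-(B : ℝ)) B) = 0 := by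
    intro B
    have hle : ∀ η : ℝ, 0 < η → η ≤ 1 →
        volume (s ∩ Set.Icc (-(B : ℝ)) B) ≤ ENNReal.ofReal ((2 * B + 3) * (2 * η)) := by
      intro η hη hη1
      obtain ⟨A, hA, hs⟩ := h η hη
      have hA0 : (1 : ℝ) ≤ A := by exact_mod_cast hA
      -- At most `(2B + 3) A` intervals of length `2η / A` are needed, so the total length does not
      -- depend on `A`.
      have hcov : s ∩ Set.Icc (-(B : ℝ)) B ⊆
          ⋃ m ∈ Finset.Icc (-(A * B + 1 : ℤ)) (A * B + 1),
            Set.Icc ((m : ℝ) / A - η / A) (m / A + η / A) := by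
        rintro t ⟨ht, ht1, ht2⟩
        obtain ⟨m, hm⟩ := hs t ht
        rw [abs_le] at hm
        simp only [Set.mem_iUnion, Finset.mem_Icc]
        refine ⟨m, ⟨?_, ?_⟩, ?_⟩
        · have : (-(A * B + 1) : ℝ) ≤ m := by nlinarith
          exact_mod_cast this
        · have : (m : ℝ) ≤ A * B + 1 := by nlinarith
          exact_mod_cast this
        · rw [← sub_div, ← add_div, Set.mem_Icc, div_le_iff₀ (by positivity),
            le_div_iff₀ (by positivity)]
          constructor <;> linarith
      refine (measure_mono hcov).trans ((measure_biUnion_finset_le _ _).trans ?_)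
      simp only [Real.volume_Icc]
      have hlen : ∀ m : ℤ, (m : ℝ) / A + η / A - (m / A - η / A) = 2 * η / A := fun m => by ring
      simp only [hlen]
      rw [Finset.sum_const, nsmul_eq_mul, Int.card_Icc, ← ENNReal.ofReal_natCast,
        ← ENNReal.ofReal_mul (by positivity)]
      refine ENNReal.ofReal_le_ofReal ?_
      have hcard : (((A * B + 1 + 1 - -(A * B + 1 : ℤ)).toNat : ℕ) : ℝ) ≤ (2 * B + 3) * A := by
        have h1 : (A * B + 1 + 1 - -(A * B + 1 : ℤ)).toNat = 2 * (A * B) + 3 := by lia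
        rw [h1]
        push_cast
        nlinarith
      calc _ ≤ (2 * B + 3) * A * (2 * η / A) := by gcongr
        _ = _ := by field_simp
    refine le_antisymm (ENNReal.le_of_forall_pos_le_add fun ε hε _ => ?_) bot_le
    have hden : (0 : ℝ) < (2 * B + 3) * 2 := by positivity
    refine (hle (min 1 (ε / ((2 * B + 3) * 2))) (lt_min one_pos (by positivity))
      (min_le_left _ _)).trans ?_
    rw [zero_add, ← ENNReal.ofReal_coe_nnreal]
    refine ENNReal.ofReal_le_ofReal ?_
    have := min_le_right 1 ((ε : ℝ) / ((2 * B + 3) * 2))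
    rw [le_div_iff₀ hden] at this
    linarith
  have hU : s ⊆ ⋃ B : ℕ, s ∩ Set.Icc (-(B : ℝ)) B := fun t ht => by
    obtain ⟨B, hB⟩ := exists_nat_ge |t|
    exact Set.mem_iUnion.2 ⟨B, ht, abs_le.1 hB⟩
  exact measure_mono_null hU (measure_iUnion_null hB)

/-! ### Arithmetic of differences and squared distances -/

namespace LatticeScheme

variable {n : ℕ} (S : LatticeScheme n)

theorem exists_int_near_mesh_mul (hd : S.d = 1) {x : Fin n → ℝ} (hx : x ∈ S.carrier) (k : ℕ)
    (i : Fin n) : ∃ m : ℤ, |S.mesh k * x i - S.shift k x i - m| ≤ 1 / (k + 1) := by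
  obtain ⟨z, hz⟩ := hx.2 k
  refine ⟨z i, ?_⟩
  have h := (norm_le_pi_norm _ i).trans hz
  simp only [hd, pow_one, Nat.sub_self, pow_zero, one_smul, Pi.sub_apply, Pi.smul_apply,
    smul_eq_mul, Real.norm_eq_abs] at h
  rwa [sub_right_comm]

/-- In `N(x - y) = (a - b) + ρ/N` the correction is of order `1/N`, yet its cross term with `N(x -
y)` has order one. This is how a shift of size `N^(-2)` becomes visible in squared distances. -/
theorem exists_int_near_mesh_sq_mul (hd : S.d = 2) {x y : Fin n → ℝ} (hx : x ∈ S.carrier)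
    (hy : y ∈ S.carrier) (k : ℕ) :
    ∃ m : ℤ, |(S.mesh k : ℝ) ^ 2 * ∑ i, (x i - y i) ^ 2
      - ∑ i, 2 * (x i - y i) * (S.shift k x i - S.shift k y i) - m| ≤ 5 * n / (k + 1) := by
  obtain ⟨a, ha⟩ := hx.2 k
  obtain ⟨b, hb⟩ := hy.2 k
  refine ⟨∑ i, (a i - b i) ^ 2, ?_⟩
  have hN1 := S.one_le_mesh_cast k
  have hNK : 16 * ((k : ℝ) + 1) * ((S.bound k : ℝ) + 2) ^ 2 ≤ S.mesh k := by
    exact_mod_cast S.le_mesh k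
  have hk0 : (0 : ℝ) ≤ k := Nat.cast_nonneg k
  have hK0 : (0 : ℝ) ≤ S.bound k := Nat.cast_nonneg _
  push_cast
  rw [Finset.mul_sum, ← Finset.sum_sub_distrib, ← Finset.sum_sub_distrib]
  refine (Finset.abs_sum_le_sum_abs _ _).trans ?_
  have hterm : ∀ i, |(S.mesh k : ℝ) ^ 2 * (x i - y i) ^ 2
      - 2 * (x i - y i) * (S.shift k x i - S.shift k y i) - ((a i : ℝ) - b i) ^ 2| ≤ 5 / ((k : ℝ) + 1) := by
    intro i
    have h1 := (norm_le_pi_norm _ i).trans ha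
    have h2 := (norm_le_pi_norm _ i).trans hb
    have h3 := (norm_le_pi_norm _ i).trans (S.norm_shift_le k x)
    have h4 := (norm_le_pi_norm _ i).trans (S.norm_shift_le k y)
    simp only [hd, Pi.sub_apply, Pi.smul_apply, smul_eq_mul, Real.norm_eq_abs, Nat.add_one_sub_one,
      pow_one] at h1 h2 h3 h4
    set N : ℝ := (S.mesh k : ℝ)
    set e := N ^ 2 * x i - N * a i - S.shift k x i with he
    set f := N ^ 2 * y i - N * b i - S.shift k y i with hf
    set ρ := S.shift k x i - S.shift k y i + (e - f) with hρ
    have hab : (a i - b i : ℝ) = N * (x i - y i) - ρ / N := by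
      rw [hρ, he, hf]; field_simp; ring
    have hid : N ^ 2 * (x i - y i) ^ 2 - 2 * (x i - y i) * (S.shift k x i - S.shift k y i)
        - ((a i : ℝ) - b i) ^ 2 = 2 * (x i - y i) * (e - f) - (ρ / N) ^ 2 := by
      rw [hab]
      have : N * (ρ / N) = ρ := mul_div_cancel₀ _ (by positivity)
      linear_combination 2 * (x i - y i) * this + 2 * (x i - y i) * hρ
    rw [hid]
    have hxy : |x i - y i| ≤ 1 := by
      have := hx.1.1 i; have := hx.1.2 i; have := hy.1.1 i; have := hy.1.2 i
      simp only [Pi.zero_apply, Pi.one_apply] at *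
      rw [abs_le]; constructor <;> linarith
    have hef : |e - f| ≤ 2 / (k + 1) := by
      refine (abs_sub _ _).trans ?_
      calc |e| + |f| ≤ 1 / (k + 1) + 1 / (k + 1) := add_le_add h1 h2
        _ = _ := by ring
    have hk1 : 2 / ((k : ℝ) + 1) ≤ 2 := div_le_self (by norm_num) (by linarith)
    have hρ' : |ρ| ≤ 2 * (S.bound k + 2) := by
      rw [hρ]
      refine (abs_add_le _ _).trans ?_
      have := abs_sub (S.shift k x i) (S.shift k y i)
      linarith
    have hρN : (ρ / N) ^ 2 ≤ 1 / (k + 1) := by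
      rw [div_pow, div_le_div_iff₀ (by positivity) (by positivity), ← sq_abs]
      have h5 : |ρ| ^ 2 ≤ (2 * (S.bound k + 2)) ^ 2 := by gcongr
      nlinarith
    refine (abs_sub _ _).trans ?_
    rw [abs_mul, abs_mul, abs_two, abs_of_nonneg (sq_nonneg (ρ / N))]
    calc 2 * |x i - y i| * |e - f| + (ρ / N) ^ 2 ≤ 2 * 1 * (2 / (k + 1)) + 1 / (k + 1) := by gcongr
      _ = _ := by ring
  refine (Finset.sum_le_sum fun i _ => hterm i).trans_eq ?_
  rw [Finset.sum_const, Finset.card_univ, Fintype.card_fin, nsmul_eq_mul]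
  ring

/-- After multiplication by the mesh, `q` contributes an integer and only the bump at `x` survives,
so its value would be a limit of integers. -/
theorem sub_ne_sub_add_rat (hd : S.d = 1)
    (hS : ∀ t, ∃ᶠ k in atTop, S.shift k = rationalBump t) {x y u v : Fin n → ℝ}
    (hx : x ∈ S.carrier) (hy : y ∈ S.carrier) (hu : u ∈ S.carrier) (hv : v ∈ S.carrier)
    (hxy : x ≠ y) (hxu : x ≠ u) (hxv : x ≠ v) (q : ℚ) (i : Fin n) :
    x i - y i ≠ u i - v i + q := by
  intro heq
  obtain ⟨t, hty, htu, htv, ht⟩ := exists_rationalBump_separating hxy hxu hxv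
    (a := Pi.single i 1) (by simp)
  refine ht (mem_range_intCast_of_frequently (C := 4) ?_)
  refine ((hS t).and_eventually (S.eventually_dvd_mesh q.den_pos)).mono ?_
  rintro k ⟨hk, ⟨r, hr⟩⟩
  obtain ⟨a, ha⟩ := S.exists_int_near_mesh_mul hd hx k i
  obtain ⟨b, hb⟩ := S.exists_int_near_mesh_mul hd hy k i
  obtain ⟨c, hc⟩ := S.exists_int_near_mesh_mul hd hu k i
  obtain ⟨e, he⟩ := S.exists_int_near_mesh_mul hd hv k i
  have hq : (S.mesh k : ℝ) * q = (r * q.num : ℤ) := by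
    rw [hr]
    push_cast
    rw [mul_comm (q.den : ℝ), mul_assoc]
    congr 1
    exact_mod_cast Rat.den_mul_eq_num q
  refine ⟨(r * q.num : ℤ) - a + b + c - e, ?_⟩
  rw [Finset.sum_eq_single i (fun j _ hj => by simp [hj]) (by simp), Pi.single_eq_same, one_mul]
  rw [hk] at ha hb hc he
  rw [hty, Pi.zero_apply, sub_zero] at hb
  rw [htu, Pi.zero_apply, sub_zero] at hc
  rw [htv, Pi.zero_apply, sub_zero] at he
  have h4 : (4 : ℝ) / (k + 1) = 4 * (1 / (k + 1)) := by ring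
  have hmul : (S.mesh k : ℝ) * x i =
      S.mesh k * y i + S.mesh k * u i - S.mesh k * v i + (r * q.num : ℤ) := by
    rw [← hq, ← mul_add, ← mul_sub, ← mul_add]
    congr 1
    linarith
  rw [abs_le] at ha hb hc he ⊢
  rw [h4]
  push_cast at hmul ⊢
  constructor <;> linarith

/-- The same argument for squares: the surviving term is the inner product of `2 (x - y)` with the
bump at `x`, chosen non-integral. -/
theorem sum_sq_ne_sum_sq_add_rat (hd : S.d = 2)
    (hS : ∀ t, ∃ᶠ k in atTop, S.shift k = rationalBump t) {x y u v : Fin n → ℝ}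
    (hx : x ∈ S.carrier) (hy : y ∈ S.carrier) (hu : u ∈ S.carrier) (hv : v ∈ S.carrier)
    (hxy : x ≠ y) (hxu : x ≠ u) (hxv : x ≠ v) (q : ℚ) :
    ∑ i, (x i - y i) ^ 2 ≠ ∑ i, (u i - v i) ^ 2 + (q : ℝ) ^ 2 := by
  intro heq
  obtain ⟨t, hty, htu, htv, ht⟩ := exists_rationalBump_separating hxy hxu hxv
    (a := (2 : ℝ) • (x - y)) (smul_ne_zero two_ne_zero (sub_ne_zero.2 hxy))
  refine ht (mem_range_intCast_of_frequently (C := 10 * n) ?_)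
  refine ((hS t).and_eventually (S.eventually_dvd_mesh q.den_pos)).mono ?_
  rintro k ⟨hk, ⟨r, hr⟩⟩
  obtain ⟨a, ha⟩ := S.exists_int_near_mesh_sq_mul hd hx hy k
  obtain ⟨b, hb⟩ := S.exists_int_near_mesh_sq_mul hd hu hv k
  have hq : (S.mesh k : ℝ) * q = (r * q.num : ℤ) := by
    rw [hr]
    push_cast
    rw [mul_comm (q.den : ℝ), mul_assoc]
    congr 1
    exact_mod_cast Rat.den_mul_eq_num q
  refine ⟨(r * q.num : ℤ) ^ 2 - a + b, ?_⟩
  rw [hk] at ha hb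
  simp only [hty, htu, htv, Pi.zero_apply, sub_zero, mul_zero, Finset.sum_const_zero] at ha hb
  simp only [Pi.smul_apply, Pi.sub_apply, smul_eq_mul]
  have hmul : (S.mesh k : ℝ) ^ 2 * ∑ i, (x i - y i) ^ 2 =
      (S.mesh k : ℝ) ^ 2 * ∑ i, (u i - v i) ^ 2 + ((r * q.num : ℤ) : ℝ) ^ 2 := by
    rw [heq, ← hq]; ring
  have h10 : (10 * n : ℝ) / (k + 1) = 2 * (5 * n / (k + 1)) := by ring
  rw [abs_le] at ha hb ⊢
  rw [h10]
  push_cast at hmul ⊢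
  constructor <;> linarith

theorem frequently_shift_eq_zero (hS : ∀ t, ∃ᶠ k in atTop, S.shift k = rationalBump t) :
    ∃ᶠ k in atTop, S.shift k = 0 :=
  (hS (0, 0, 0)).mono fun k hk => by
    rw [hk]
    ext x i
    simp [rationalBump]

theorem exists_shift_eq_zero_of_pos (hS : ∀ t, ∃ᶠ k in atTop, S.shift k = rationalBump t)
    (C : ℝ) {η : ℝ} (hη : 0 < η) : ∃ k : ℕ, S.shift k = 0 ∧ C / ((k : ℝ) + 1) ≤ η := by
  have hlim : Tendsto (fun k : ℕ => C / ((k : ℝ) + 1)) atTop (𝓝 0) :=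
    (tendsto_atTop_add_const_right _ _ tendsto_natCast_atTop_atTop).const_div_atTop C
  exact ((S.frequently_shift_eq_zero hS).and_eventually
    (hlim.eventually (ge_mem_nhds hη))).exists

theorem volume_differences (hd : S.d = 1) (hS : ∀ t, ∃ᶠ k in atTop, S.shift k = rationalBump t)
    (i : Fin n) : volume {s : ℝ | ∃ x ∈ S.carrier, ∃ y ∈ S.carrier, s = x i - y i} = 0 := by
  refine volume_eq_zero_of_near_int fun η hη => ?_
  obtain ⟨k, hk, hkη⟩ := S.exists_shift_eq_zero_of_pos hS 2 hη
  refine ⟨S.mesh k, S.mesh_pos k, ?_⟩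
  rintro _ ⟨x, hx, y, hy, rfl⟩
  obtain ⟨a, ha⟩ := S.exists_int_near_mesh_mul hd hx k i
  obtain ⟨b, hb⟩ := S.exists_int_near_mesh_mul hd hy k i
  simp only [hk, Pi.zero_apply, sub_zero] at ha hb
  refine ⟨a - b, le_trans ?_ hkη⟩
  have h2 : (2 : ℝ) / (k + 1) = 2 * (1 / (k + 1)) := by ring
  rw [abs_le] at ha hb ⊢
  rw [h2]
  push_cast
  constructor <;> linarith

theorem volume_sum_sq (hd : S.d = 2) (hS : ∀ t, ∃ᶠ k in atTop, S.shift k = rationalBump t) :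
    volume {s : ℝ | ∃ x ∈ S.carrier, ∃ y ∈ S.carrier, s = ∑ i, (x i - y i) ^ 2} = 0 := by
  refine volume_eq_zero_of_near_int fun η hη => ?_
  obtain ⟨k, hk, hkη⟩ := S.exists_shift_eq_zero_of_pos hS (5 * n) hη
  refine ⟨S.mesh k ^ 2, pow_pos (S.mesh_pos k) 2, ?_⟩
  rintro _ ⟨x, hx, y, hy, rfl⟩
  obtain ⟨a, ha⟩ := S.exists_int_near_mesh_sq_mul hd hx hy k
  simp only [hk, Pi.zero_apply, sub_zero, mul_zero, Finset.sum_const_zero] at ha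
  refine ⟨a, le_trans ?_ hkη⟩
  push_cast
  exact ha

end LatticeScheme

/-! ### Assembly of the theorem -/

/-- Coordinate form of the theorem, with squared distances. -/
theorem exists_compact_squared_distances (n : ℕ) (hn : 1 ≤ n) :
    ∃ F : Set (Fin n → ℝ), IsCompact F ∧ dimH F = max 1 ((n : ENNReal) / 2) ∧
      volume {s : ℝ | ∃ x ∈ F, ∃ y ∈ F, s = ∑ i, (x i - y i) ^ 2} = 0 ∧
      (∀ x ∈ F, ∀ y ∈ F, x ≠ y → ∀ q : ℚ, ∑ i, (x i - y i) ^ 2 ≠ (q : ℝ) ^ 2) ∧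
      ∀ x ∈ F, ∀ y ∈ F, ∀ u ∈ F, ∀ v ∈ F, x ≠ y → x ≠ u → x ≠ v →
        ∑ i, (x i - y i) ^ 2 ≠ ∑ i, (u i - v i) ^ 2 := by
  rcases hn.eq_or_lt with rfl | hn2
  · obtain ⟨S, hd, hS⟩ := exists_latticeScheme 1 one_pos
    refine ⟨S.carrier, S.isCompact_carrier, ?_, ?_, ?_, ?_⟩
    · rw [S.dimH_carrier, hd, Nat.cast_one, div_one, max_eq_left]
      exact ENNReal.div_le_of_le_mul (by norm_num)
    · have h := addHaar_image_eq_zero_of_differentiableOn_of_addHaar_eq_zero volume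
        (f := fun s : ℝ => s ^ 2) (by fun_prop) (S.volume_differences hd hS 0)
      refine measure_mono_null ?_ h
      rintro _ ⟨x, hx, y, hy, rfl⟩
      exact ⟨_, ⟨x, hx, y, hy, rfl⟩, by simp⟩
    · intro x hx y hy hxy q h
      rw [Fin.sum_univ_one, sq_eq_sq_iff_eq_or_eq_neg] at h
      rcases h with h | h
      · exact S.sub_ne_sub_add_rat hd hS hx hy hy hy hxy hxy hxy q 0 (by linarith)
      · exact S.sub_ne_sub_add_rat hd hS hx hy hy hy hxy hxy hxy (-q) 0 (by push_cast; linarith)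
    · intro x hx y hy u hu v hv hxy hxu hxv h
      rw [Fin.sum_univ_one, Fin.sum_univ_one, sq_eq_sq_iff_eq_or_eq_neg] at h
      -- The sign ambiguity of the square root amounts to exchanging `u` and `v`.
      rcases h with h | h
      · exact S.sub_ne_sub_add_rat hd hS hx hy hu hv hxy hxu hxv 0 0 (by push_cast; linarith)
      · exact S.sub_ne_sub_add_rat hd hS hx hy hv hu hxy hxv hxu 0 0 (by push_cast; linarith)
  · obtain ⟨S, hd, hS⟩ := exists_latticeScheme n two_pos
    refine ⟨S.carrier, S.isCompact_carrier, ?_, S.volume_sum_sq hd hS, ?_, ?_⟩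
    · rw [S.dimH_carrier, hd, Nat.cast_two, max_eq_right]
      rw [ENNReal.le_div_iff_mul_le (by simp) (by simp), one_mul]
      exact_mod_cast hn2
    · intro x hx y hy hxy q h
      exact S.sum_sq_ne_sum_sq_add_rat hd hS hx hy hy hy hxy hxy hxy q (by simpa using h)
    · intro x hx y hy u hu v hv hxy hxu hxv h
      exact S.sum_sq_ne_sum_sq_add_rat hd hS hx hy hu hv hxy hxu hxv 0 (by simpa using h)

/-- Applied to `x` and, by symmetry, to `y`, the hypothesis puts both in `{u, v}`; as `x ≠ y`, the
pairs coincide. -/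
theorem realisesDistancesAtMostOnce_of_ne {n : ℕ} {E : Set (EuclideanSpace ℝ (Fin n))}
    (h : ∀ x ∈ E, ∀ y ∈ E, ∀ u ∈ E, ∀ v ∈ E, x ≠ y → x ≠ u → x ≠ v → ‖x - y‖ ≠ ‖u - v‖) :
    RealisesDistancesAtMostOnce E := by
  intro x hx y hy u hu v hv hxy heq
  have huv : u ≠ v := fun h' => hxy (sub_eq_zero.1 (norm_eq_zero.1 (by rw [heq, h']; simp)))
  have hx' : x = u ∨ x = v := by
    by_contra! hne
    exact h x hx y hy u hu v hv hxy hne.1 hne.2 heq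
  have hy' : y = u ∨ y = v := by
    by_contra! hne
    exact h y hy x hx u hu v hv hxy.symm hne.1 hne.2 (by rw [norm_sub_rev, heq])
  grind

theorem theorem5p1 (n : ℕ) (hn : 1 ≤ n) :
    ∃ E : Set (EuclideanSpace ℝ (Fin n)),
      IsCompact E ∧
      dimH E = max 1 ((n : ENNReal) / 2) ∧
      MeasureTheory.volume (distanceSet E) = 0 ∧
      (∀ q : ℚ, q ≠ 0 → (q : ℝ) ∉ distanceSet E) ∧
      RealisesDistancesAtMostOnce E := by
  obtain ⟨F, hF, hdim, hvol, hrat, hdist⟩ := exists_compact_squared_distances n hn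
  let e := (EuclideanSpace.equiv (Fin n) ℝ).symm
  have hnorm : ∀ x y, ‖e x - e y‖ ^ 2 = ∑ i, (x i - y i) ^ 2 := fun x y => by
    rw [EuclideanSpace.real_norm_sq_eq]
    rfl
  refine ⟨e '' F, hF.image e.continuous, by rw [e.dimH_image, hdim], ?_, ?_, ?_⟩
  -- Differentiable maps preserve null sets; the square root fails to be differentiable at `0`,
  -- which is removed and restored as a null singleton.
  · have h := addHaar_image_eq_zero_of_differentiableOn_of_addHaar_eq_zero volume (f := Real.sqrt)
      (s := {s : ℝ | ∃ x ∈ F, ∃ y ∈ F, s = ∑ i, (x i - y i) ^ 2} \ {0})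
      (fun s hs => (Real.hasDerivAt_sqrt hs.2).differentiableAt.differentiableWithinAt)
      (measure_mono_null Set.sdiff_subset hvol)
    refine measure_mono_null ?_ (measure_union_null h (measure_singleton (0 : ℝ)))
    rintro _ ⟨_, ⟨x, hx, rfl⟩, _, ⟨y, hy, rfl⟩, rfl⟩
    rcases eq_or_ne ‖e x - e y‖ 0 with h0 | h0
    · exact Or.inr h0
    · exact Or.inl ⟨‖e x - e y‖ ^ 2, ⟨⟨x, hx, y, hy, hnorm x y⟩, pow_ne_zero 2 h0⟩,
        Real.sqrt_sq (norm_nonneg _)⟩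
  · rintro q hq ⟨_, ⟨x, hx, rfl⟩, _, ⟨y, hy, rfl⟩, h⟩
    refine hrat x hx y hy ?_ q (by rw [← hnorm, ← h])
    rintro rfl
    simp [hq] at h
  · refine realisesDistancesAtMostOnce_of_ne ?_
    rintro _ ⟨x, hx, rfl⟩ _ ⟨y, hy, rfl⟩ _ ⟨u, hu, rfl⟩ _ ⟨v, hv, rfl⟩ hxy hxu hxv h
    refine hdist x hx y hy u hu v hv (fun h' => hxy (h' ▸ rfl)) (fun h' => hxu (h' ▸ rfl))
      (fun h' => hxv (h' ▸ rfl)) ?_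
    rw [← hnorm, ← hnorm, h]
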